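/- Let $d\ge 2$ and let $\mathcal S\subseteq\{1,\dots,d\}$ be a fixed set of coordinates with $S=\mathrm{Card}\,\mathcal S\ge 2$. For each $n$ let $p_{n1},\dots,p_{nd}\in(0,1)$ with $\sum_{j}p_{nj}=1$. **The forest.** Given $k_n>0$, a random tree partition $\Theta$ of $[0,1]^d$ is obtained by starting from the single cell $[0,1]^d$ and repeating $\lceil\log_2 k_n\rceil$ times (zero times if $k_n\le 1$) the following step: every current cell is cut at the midpoint of its $j$-th side, where the coordinate $j$ is selected, independently for each cell, with probability $p_{nj}$. Let $(\mathbf X_1,Y_1),\dots,(\mathbf X_n,Y_n)$ be i.i.d. copies of $(\mathbf X,Y)$, with $(\mathbf X,Y)$, the sample and $\Theta$ independent. With $A_n(\mathbf x,\Theta)$ the cell containing $\mathbf x$, put $$\bar r_n(\mathbf x)=\mathbb E_\Theta\left[\frac{\sum_{i=1}^n Y_i\mathbf 1_{[\mathbf X_i\in A_n(\mathbf x,\Theta)]}}{\sum_{i=1}^n \mathbf 1_{[\mathbf X_i\in A_n(\mathbf x,\Theta)]}}\right],$$ the quotient being $0$ when the cell contains no $\mathbf X_i$; $\mathbb E_\Theta$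 is the expectation with respect to $\Theta$ only. **The class.** For $L,\sigma^2>0$, let $\mathcal F_S$ be the class of distributions of pairs $(\mathbf X,Y)$ with $\mathbf X$ uniform on $[0,1]^d$, $\mathbb E Y^2<\infty$, $\mathbb E[Y\mid\mathbf X]=r(\mathbf X)$ almost surely where $r(\mathbf x)=r^\star(\mathbf x_{\mathcal S})$ and $r^\star:[0,1]^S\to\mathbb R$ is Lipschitz with constant $L$ for the Euclidean metric, and $\mathbb V[Y\mid\mathbf X]\le\sigma^2$ almost surely. For such a distribution put $$\Xi=C\sigma^2\left(\frac{S^2}{S-1}\right)^{S/2d}+2e^{-1}\sup_{\mathbf x\in[0,1]^d}r^2(\mathbf x),\qquad C=\frac{288}{\pi}\left(\frac{\pi\log 2}{16}\right)^{S/2d}.$$ **Claim.** Suppose $p_{nj}=\frac1S(1+\xi_{nj})$ for $j\in\mathcal S$, with $\xi_{nj}\log n\to0$ as $n\to\infty$ for each $j\in\mathcal S$, let $c>0$, and choose $$k_n=c\left(\frac{L^2}{\Xi}\right)^{1/(1+\frac{0.75}{S\log 2})}n^{1/(1+\frac{0.75}{S\log 2})}.$$ Then there is a constant $\Lambda>0$,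 independent of $r$, $L$ and $\sigma^2$, such that for all $L,\sigma^2>0$ $$\limsup_{n\to\infty}\ \sup_{(\mathbf X,Y)\in\mathcal F_S}\ \frac{\mathbb E\left[\bar r_n(\mathbf X)-r(\mathbf X)\right]^2}{\left(\Xi L^{\frac{2S\log 2}{0.75}}\right)^{\frac{0.75}{S\log 2+0.75}}n^{\frac{-0.75}{S\log 2+0.75}}}\le\Lambda .$$ -/

import Mathlib

open MeasureTheory ProbabilityTheory Set Filter Topology
open scoped ENNReal

noncomputable section

namespace RandomForest

/-! ### Random cut trees -/

/-- Complete binary trees of depth `K` whose internal nodes carry the coordinate, among `d`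
candidates, along which the cell of that node is cut: a realization of the randomizing
variable `Θ`. -/
def CutTree (d : ℕ) : ℕ → Type
  | 0 => Unit
  | K + 1 => Fin d × CutTree d K × CutTree d K

instance CutTree.instFintype (d : ℕ) : (K : ℕ) → Fintype (CutTree d K)
  | 0 => inferInstanceAs (Fintype Unit)
  | K + 1 =>
    letI := CutTree.instFintype d K
    inferInstanceAs (Fintype (Fin d × CutTree d K × CutTree d K))

/-- The probability of a cut tree when, at each node independently, coordinate `j` is selected
with probability `q j`. -/
def CutTree.prob {d : ℕ} (q : Fin d → ℝ) : {K : ℕ} → CutTree d K → ℝ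
  | 0, _ => 1
  | _ + 1, (j, left, right) => q j * CutTree.prob q left * CutTree.prob q right

/-- Starting from the box with lower corner `lo` and upper corner `hi`, follow the point `x` down
the tree, every cut being made at the midpoint of the chosen side of the current cell; the result
is the set of points that lie on the same side as `x` of every cut met on the way. -/
def CutTree.sameSide {d : ℕ} :
    {K : ℕ} → CutTree d K → (lo hi x : Fin d → ℝ) → Set (Fin d → ℝ)
  | 0, _, _, _, _ => univ
  | _ + 1, (j, left, right), lo, hi, x =>
    let m := (lo j + hi j) / 2
    if x j < m then
      {y | y j < m} ∩ CutTree.sameSide left lo (Function.update hi j m) x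
    else
      {y | m ≤ y j} ∩ CutTree.sameSide right (Function.update lo j m) hi x

/-- The cell `A_n(x, Θ)`, containing `x`, of the partition of `[0,1]^d` given by a cut tree. -/
def CutTree.cell {d K : ℕ} (T : CutTree d K) (x : Fin d → ℝ) : Set (Fin d → ℝ) :=
  Icc 0 1 ∩ T.sameSide 0 1 x

/-! ### The regression estimates -/

/-- The number `N_n(x, Θ)` of data points in the cell of `x`. -/
def CutTree.count {d K n : ℕ} (T : CutTree d K) (D : Fin n → (Fin d → ℝ) × ℝ)
    (x : Fin d → ℝ) : ℝ :=
  ∑ i, (T.cell x).indicator (fun _ => (1 : ℝ)) (D i).1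

open Classical in
/-- The estimate of a single tree: the average of the responses in the cell of `x`,
and `0` if that cell is empty. -/
def CutTree.estimate {d K n : ℕ} (T : CutTree d K) (D : Fin n → (Fin d → ℝ) × ℝ)
    (x : Fin d → ℝ) : ℝ :=
  if T.count D x = 0 then 0
  else (∑ i, (T.cell x).indicator (fun _ => (D i).2) (D i).1) / T.count D x

/-- The forest estimate: the expectation over the random tree (independent of the data) of the
tree estimates, for trees built by `⌈log₂ k⌉` successive rounds of cuts
(no cut at all if `k ≤ 1`). -/
def forest {d n : ℕ} (q : Fin d → ℝ) (k : ℝ) (D : Fin n → (Fin d → ℝ) × ℝ)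
    (x : Fin d → ℝ) : ℝ :=
  ∑ T : CutTree d ⌈Real.logb 2 k⌉₊, T.prob q * T.estimate D x

/-- The function on `ℝ^d` that depends on the coordinates in `𝒮` only, with section `rs`. -/
def lift {d : ℕ} {𝒮 : Finset (Fin d)} (rs : (𝒮 → ℝ) → ℝ) (x : Fin d → ℝ) : ℝ :=
  rs fun j => x j

/-- The `L²` risk `𝔼 [r̄_n(X) - r(X)]²`, where the sample `D` consists of `n` independent copies
of `(X, Y)` and is independent of `(X, Y)`, and `(X, Y)` has law `P`. -/
def risk {d : ℕ} (n : ℕ) (q : Fin d → ℝ) (k : ℝ) (P : Measure ((Fin d → ℝ) × ℝ))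
    (r : (Fin d → ℝ) → ℝ) : ℝ≥0∞ :=
  ∫⁻ w, ENNReal.ofReal ((forest q k w.1 w.2.1 - r w.2.1) ^ 2)
    ∂((Measure.pi fun _ : Fin n => P).prod P)

/-! ### The class of distributions -/

/-- `P` is the law of a pair `(X, Y)` in the class of `(L, σ²)`-smooth distributions with set of
strong coordinates `𝒮`, and `rs` is the section of its regression function. -/
structure IsSmooth {d : ℕ} (𝒮 : Finset (Fin d)) (L σ2 : ℝ)
    (P : Measure ((Fin d → ℝ) × ℝ)) (rs : (𝒮 → ℝ) → ℝ) : Prop where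
  isProb : IsProbabilityMeasure P
  /-- `X` is uniformly distributed on `[0,1]^d`. -/
  uniform : P.map Prod.fst = volume.restrict (Icc 0 1)
  /-- `𝔼 Y² < ∞`. -/
  memLp : MemLp (fun z => z.2) 2 P
  /-- `𝔼[Y | X] = rs(X_𝒮)` almost surely. -/
  regression : P[fun z => z.2 | MeasurableSpace.comap Prod.fst inferInstance]
    =ᵐ[P] fun z => lift rs z.1
  /-- `rs` is Lipschitz with constant `L` on `[0,1]^𝒮`, for the Euclidean metric. -/
  lipschitz : ∀ u ∈ Icc (0 : 𝒮 → ℝ) 1, ∀ v ∈ Icc (0 : 𝒮 → ℝ) 1,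
    |rs u - rs v| ≤ L * √(∑ j, (u j - v j) ^ 2)
  /-- `𝕍[Y | X] ≤ σ²` almost surely. -/
  variance_le : Var[fun z => z.2; P | MeasurableSpace.comap Prod.fst inferInstance]
    ≤ᵐ[P] fun _ => σ2

/-! ### The constants -/

/-- `C = (288/π) (π log 2 / 16)^{S/2d}`. -/
def constC (d S : ℕ) : ℝ :=
  288 / Real.pi * (Real.pi * Real.log 2 / 16) ^ ((S : ℝ) / (2 * d))

/-- `Ξ = C σ² (S²/(S-1))^{S/2d} + 2 e⁻¹ sup_{x ∈ [0,1]^d} r(x)²`. -/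
def Xi (d S : ℕ) (σ2 : ℝ) (r : (Fin d → ℝ) → ℝ) : ℝ :=
  constC d S * σ2 * ((S : ℝ) ^ 2 / ((S : ℝ) - 1)) ^ ((S : ℝ) / (2 * d))
    + 2 * Real.exp (-1) * ⨆ x : Icc (0 : Fin d → ℝ) 1, r x ^ 2

/-- `k_n = c (L²/Ξ)^{1/(1 + 0.75/(S log 2))} n^{1/(1 + 0.75/(S log 2))}`. -/
def kChoice (S : ℕ) (c L Ξ : ℝ) (n : ℕ) : ℝ :=
  c * (L ^ 2 / Ξ) ^ (1 / (1 + 0.75 / (S * Real.log 2)))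
    * (n : ℝ) ^ (1 / (1 + 0.75 / (S * Real.log 2)))

/-- `(Ξ L^{2 S log 2 / 0.75})^{0.75/(S log 2 + 0.75)} n^{-0.75/(S log 2 + 0.75)}`. -/
def rate (S : ℕ) (L Ξ : ℝ) (n : ℕ) : ℝ :=
  (Ξ * L ^ (2 * S * Real.log 2 / 0.75)) ^ (0.75 / (S * Real.log 2 + 0.75))
    * (n : ℝ) ^ (-0.75 / (S * Real.log 2 + 0.75))

end RandomForest

end

/-! The weights of the trees are nonnegative and sum to one, so by convexity of the square the risk
of the forest is at most the mean risk of a single tree (`sq_forest_sub_le`). Averaging over trees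
need not reduce the variance further for the claimed rate.

Fix a tree of depth K and a point x. Every cut halves one side, so the cell of x has volume exactly
v = 2^{-K}, and its side along j has length 2^{-c_j}, where c_j counts the cuts along j on the way
to x. A local average over such a cell has risk at most 2σ²/((n+1)v) (variance), plus L² ∑_{j∈𝒮}
4^{-c_j} (squared bias, as r is Lipschitz in the strong coordinates only), plus r(x)²(1-v)^n (empty
cell): see `lintegral_sq_average_sub_le`. Averaged over trees, 4^{-c_j} becomes (1 - 3p_j/4)^K
(`sum_prob_mul_pow_cuts`), which gives `IsSmooth.risk_le`.

With K = ⌈log₂ k⌉ and α = 0.75/(S log 2), the three terms are of order σ²k/n, L²k^{-α} and (sup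
r²)k/n. Since Ξ dominates multiples of both σ² and sup r², the first and third are O(Ξk/n), and the
chosen k makes Ξk/n and L²k^{-α} constant multiples of the rate. Uniformity needs care because Ξ is
unbounded over the class: k may be at most 1 for any n, and log k is controlled only through the
lower bound of Ξ by a multiple of σ². -/

namespace RandomForest

/-! ### Geometry and law of the random cells -/

namespace CutTree

variable {d K : ℕ}

/-- The number of cuts along each coordinate met by `x` on its way down the tree. -/
noncomputable def cuts {d : ℕ} :
    {K : ℕ} → CutTree d K → (lo hi x : Fin d → ℝ) → Fin d → ℕ
  | 0, _, _, _, _ => 0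
  | _ + 1, (j, left, right), lo, hi, x =>
    Pi.single j 1 +
      if x j < (lo j + hi j) / 2 then
        cuts left lo (Function.update hi j ((lo j + hi j) / 2)) x
      else
        cuts right (Function.update lo j ((lo j + hi j) / 2)) hi x

theorem sum_succ (f : CutTree d (K + 1) → ℝ) :
    ∑ T, f T = ∑ j : Fin d, ∑ l : CutTree d K, ∑ r : CutTree d K, f (j, l, r) := by
  have h := Fintype.sum_prod_type (α₁ := Fin d) (α₂ := CutTree d K × CutTree d K) f
  simp only [Fintype.sum_prod_type] at h
  exact h

theorem sum_zero (f : CutTree d 0 → ℝ) : ∑ T, f T = f () :=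
  Fintype.sum_unique (ι := Unit) f

theorem prob_nonneg {q : Fin d → ℝ} (hq : ∀ j, 0 ≤ q j) :
    ∀ {K : ℕ} (T : CutTree d K), 0 ≤ T.prob q
  | 0, _ => zero_le_one
  | _ + 1, (j, l, r) =>
    mul_nonneg (mul_nonneg (hq j) (prob_nonneg hq l)) (prob_nonneg hq r)

theorem sum_prob {q : Fin d → ℝ} (hq : ∑ j, q j = 1) (K : ℕ) :
    ∑ T : CutTree d K, T.prob q = 1 := by
  induction K with
  | zero => rw [sum_zero]; rfl
  | succ K ih =>
    rw [sum_succ]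
    simp only [prob, ← Finset.mul_sum, ih, mul_one, hq]

/-- The expectation of the squared relative side length of the cell of `x` along `j`. -/
theorem sum_prob_mul_pow_cuts {q : Fin d → ℝ} (hq : ∑ j, q j = 1) (s : ℝ) (j : Fin d) (K : ℕ)
    (lo hi x : Fin d → ℝ) :
    ∑ T : CutTree d K, T.prob q * s ^ T.cuts lo hi x j = (1 - (1 - s) * q j) ^ K := by
  induction K generalizing lo hi with
  | zero => rw [sum_zero]; simp [prob, cuts]
  | succ K ih =>
    rw [sum_succ]
    -- Condition on the root coordinate i: it contributes a factor s exactly when i = j. Only the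
    -- child entered by x matters, since the probabilities of the other subtree sum to 1.
    have key : ∀ i : Fin d, ∑ l : CutTree d K, ∑ r : CutTree d K,
        prob q (K := K + 1) (i, l, r) * s ^ cuts (K := K + 1) (i, l, r) lo hi x j
        = q i * (if i = j then s else 1) * (1 - (1 - s) * q j) ^ K := by
      intro i
      have hs : s ^ (Pi.single i 1 : Fin d → ℕ) j = if i = j then s else 1 := by
        by_cases h : i = j
        · subst h; simp
        · simp [h]
      simp only [prob, cuts, Pi.add_apply, pow_add, hs]
      by_cases h2 : x i < (lo i + hi i) / 2
      · simp only [h2, if_true]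
        rw [← ih lo (Function.update hi i ((lo i + hi i) / 2)), Finset.mul_sum]
        refine Finset.sum_congr rfl fun l _ => ?_
        simp only [mul_right_comm _ (prob q _) (_ * _), ← Finset.mul_sum, sum_prob hq K]
        ring
      · simp only [h2, if_false]
        rw [Finset.sum_comm, ← ih (Function.update lo i ((lo i + hi i) / 2)) hi, Finset.mul_sum]
        refine Finset.sum_congr rfl fun r _ => ?_
        simp only [mul_assoc (q i), mul_left_comm (q i) (prob q _), mul_assoc (prob q _),
          ← Finset.sum_mul, sum_prob hq K]
        ring
    simp only [key, ← Finset.sum_mul]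
    rw [pow_succ, mul_comm]
    congr 1
    have : ∀ i, q i * (if i = j then s else 1) = q i - if i = j then (1 - s) * q i else 0 := by
      intro i; split_ifs <;> ring
    simp only [this, Finset.sum_sub_distrib, hq, Finset.sum_ite_eq', Finset.mem_univ, if_true]

theorem sum_cuts (T : CutTree d K) (lo hi x : Fin d → ℝ) : ∑ j, T.cuts lo hi x j = K := by
  induction K generalizing lo hi with
  | zero => simp [cuts]
  | succ K ih =>
    obtain ⟨j, l, r⟩ := T
    simp only [cuts, Pi.add_apply, Finset.sum_add_distrib]
    split_ifs <;> simp [ih, add_comm]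

/-- Half-open boxes are stable under the cuts, since a cut separates `y j < m` from `m ≤ y j`. The
closed cube used in `cell` differs from the half-open one by a null set only. -/
theorem exists_box (T : CutTree d K) (lo hi x : Fin d → ℝ)
    (hx : x ∈ univ.pi fun j => Ico (lo j) (hi j)) :
    ∃ lo' hi' : Fin d → ℝ, x ∈ (univ.pi fun j => Ico (lo' j) (hi' j)) ∧
      (univ.pi fun j => Ico (lo j) (hi j)) ∩ T.sameSide lo hi x
        = (univ.pi fun j => Ico (lo' j) (hi' j)) ∧
      ∀ j, hi' j - lo' j = (hi j - lo j) * (1 / 2) ^ T.cuts lo hi x j := by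
  induction K generalizing lo hi with
  | zero => exact ⟨lo, hi, hx, by simp [sameSide], by simp [cuts]⟩
  | succ K ih =>
    obtain ⟨j, l, r⟩ := T
    simp only [sameSide, cuts]
    set m := (lo j + hi j) / 2 with hm
    have hj := hx j (mem_univ j)
    have hlt : lo j < m ∧ m < hi j := by
      have := hj.1.trans_lt hj.2
      constructor <;> rw [hm] <;> linarith
    split_ifs with h
    · have hx' : x ∈ univ.pi fun i => Ico (lo i) (Function.update hi j m i) := by
        intro i _
        rcases eq_or_ne i j with rfl | hi'
        · simpa using ⟨hj.1, h⟩
        · simpa [hi'] using hx i (mem_univ i)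
      obtain ⟨lo', hi', h1, h2, h3⟩ := ih l lo (Function.update hi j m) hx'
      refine ⟨lo', hi', h1, ?_, fun i => ?_⟩
      · rw [← h2, ← inter_assoc]
        congr 1
        ext y
        simp only [mem_inter_iff, Set.mem_pi, mem_univ, mem_Ico, true_imp_iff, mem_ofPred_eq]
        constructor
        · rintro ⟨hy, hyj⟩ i
          rcases eq_or_ne i j with rfl | hne
          · simpa using ⟨(hy i).1, hyj⟩
          · simpa [hne] using hy i
        · intro hy
          have hyj : y j < m := by simpa using (hy j).2
          refine ⟨fun i => ?_, hyj⟩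
          rcases eq_or_ne i j with rfl | hne
          · exact ⟨(hy i).1, hyj.trans hlt.2⟩
          · simpa [hne] using hy i
      · rw [h3 i, Pi.add_apply, pow_add]
        rcases eq_or_ne i j with rfl | hne
        · simp [hm]; ring
        · simp [hne]
    · rw [not_lt] at h
      have hx' : x ∈ univ.pi fun i => Ico (Function.update lo j m i) (hi i) := by
        intro i _
        rcases eq_or_ne i j with rfl | hi'
        · simpa using ⟨h, hj.2⟩
        · simpa [hi'] using hx i (mem_univ i)
      obtain ⟨lo', hi', h1, h2, h3⟩ := ih r (Function.update lo j m) hi hx'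
      refine ⟨lo', hi', h1, ?_, fun i => ?_⟩
      · rw [← h2, ← inter_assoc]
        congr 1
        ext y
        simp only [mem_inter_iff, Set.mem_pi, mem_univ, mem_Ico, true_imp_iff, mem_ofPred_eq]
        constructor
        · rintro ⟨hy, hyj⟩ i
          rcases eq_or_ne i j with rfl | hne
          · simpa using ⟨hyj, (hy i).2⟩
          · simpa [hne] using hy i
        · intro hy
          have hyj : m ≤ y j := by simpa using (hy j).1
          refine ⟨fun i => ?_, hyj⟩
          rcases eq_or_ne i j with rfl | hne
          · exact ⟨hlt.1.le.trans hyj, (hy i).2⟩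
          · simpa [hne] using hy i
      · rw [h3 i, Pi.add_apply, pow_add]
        rcases eq_or_ne i j with rfl | hne
        · simp [hm]; ring
        · simp [hne]

theorem measurableSet_sameSide (T : CutTree d K) (lo hi : Fin d → ℝ) :
    MeasurableSet {z : (Fin d → ℝ) × (Fin d → ℝ) | z.2 ∈ T.sameSide lo hi z.1} := by
  induction K generalizing lo hi with
  | zero => simp [sameSide]
  | succ K ih =>
    obtain ⟨j, l, r⟩ := T
    set m := (lo j + hi j) / 2 with hm
    have : {z : (Fin d → ℝ) × (Fin d → ℝ) |
          z.2 ∈ sameSide (K := K + 1) (j, l, r) lo hi z.1} =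
        ({z | z.1 j < m} ∩ ({z | z.2 j < m} ∩
          {z | z.2 ∈ l.sameSide lo (Function.update hi j m) z.1})) ∪
        ({z | m ≤ z.1 j} ∩ ({z | m ≤ z.2 j} ∩
          {z | z.2 ∈ r.sameSide (Function.update lo j m) hi z.1})) := by
      ext z
      by_cases h : z.1 j < m
      · simp [sameSide, ← hm, h, not_le.2 h]
      · simp [sameSide, ← hm, h, not_lt.1 h]
    rw [this]
    have h1 : Measurable fun z : (Fin d → ℝ) × (Fin d → ℝ) => z.1 j := by fun_prop
    have h2 : Measurable fun z : (Fin d → ℝ) × (Fin d → ℝ) => z.2 j := by fun_prop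
    exact ((measurableSet_lt h1 measurable_const).inter
      ((measurableSet_lt h2 measurable_const).inter (ih _ _ _))).union
      ((measurableSet_le measurable_const h1).inter
      ((measurableSet_le measurable_const h2).inter (ih _ _ _)))

theorem measurableSet_mem_cell (T : CutTree d K) :
    MeasurableSet {z : (Fin d → ℝ) × (Fin d → ℝ) | z.2 ∈ T.cell z.1} :=
  (measurable_snd measurableSet_Icc).inter (T.measurableSet_sameSide 0 1)

theorem measurableSet_cell (T : CutTree d K) (x : Fin d → ℝ) : MeasurableSet (T.cell x) :=
  measurable_prodMk_left (x := x) T.measurableSet_mem_cell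

theorem measurable_estimate (T : CutTree d K) (n : ℕ) :
    Measurable fun w : (Fin n → (Fin d → ℝ) × ℝ) × (Fin d → ℝ) => T.estimate w.1 w.2 := by
  have hset : ∀ i : Fin n, MeasurableSet
      {w : (Fin n → (Fin d → ℝ) × ℝ) × (Fin d → ℝ) | (w.1 i).1 ∈ T.cell w.2} := fun i =>
    (show Measurable fun w : (Fin n → (Fin d → ℝ) × ℝ) × (Fin d → ℝ) => (w.2, (w.1 i).1)
      by fun_prop) T.measurableSet_mem_cell
  have hcount : Measurable
      fun w : (Fin n → (Fin d → ℝ) × ℝ) × (Fin d → ℝ) => T.count w.1 w.2 := by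
    refine Finset.measurable_sum _ fun i _ => ?_
    exact (measurable_const (a := (1 : ℝ))).indicator (hset i)
  have hsum : Measurable fun w : (Fin n → (Fin d → ℝ) × ℝ) × (Fin d → ℝ) =>
      ∑ i, (T.cell w.2).indicator (fun _ => (w.1 i).2) (w.1 i).1 := by
    refine Finset.measurable_sum _ fun i _ => ?_
    exact (show Measurable fun w : (Fin n → (Fin d → ℝ) × ℝ) × (Fin d → ℝ) => (w.1 i).2
      by fun_prop).indicator (hset i)
  exact Measurable.ite (hcount (measurableSet_singleton 0)) measurable_const (hsum.div hcount)

theorem cell_ae_eq_box (T : CutTree d K) (x : Fin d → ℝ) :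
    T.cell x =ᵐ[volume] ((univ.pi fun j => Ico ((0 : Fin d → ℝ) j) ((1 : Fin d → ℝ) j)) ∩
      T.sameSide 0 1 x : Set (Fin d → ℝ)) :=
  (Measure.univ_pi_Ico_ae_eq_Icc (μ := fun _ : Fin d => (volume : Measure ℝ))
    (f := 0) (g := 1)).symm.inter ae_eq_rfl

theorem volume_cell (T : CutTree d K) {x : Fin d → ℝ}
    (hx : x ∈ univ.pi fun j => Ico ((0 : Fin d → ℝ) j) ((1 : Fin d → ℝ) j)) :
    volume (T.cell x) = ENNReal.ofReal ((1 / 2) ^ K) := by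
  obtain ⟨lo, hi, h1, h2, h3⟩ := T.exists_box 0 1 x hx
  rw [measure_congr (T.cell_ae_eq_box x), h2, Real.volume_pi_Ico,
    ← ENNReal.ofReal_prod_of_nonneg fun j _ => by rw [h3]; simp]
  congr 1
  simp only [h3, Pi.one_apply, Pi.zero_apply, sub_zero, one_mul]
  rw [Finset.prod_pow_eq_pow_sum, sum_cuts]

theorem ae_sq_sub_le_of_mem_cell (T : CutTree d K) {x : Fin d → ℝ}
    (hx : x ∈ univ.pi fun j => Ico ((0 : Fin d → ℝ) j) ((1 : Fin d → ℝ) j)) :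
    ∀ᵐ y : Fin d → ℝ, y ∈ T.cell x → ∀ j, (y j - x j) ^ 2 ≤ (1 / 4) ^ T.cuts 0 1 x j := by
  obtain ⟨lo, hi, h1, h2, h3⟩ := T.exists_box 0 1 x hx
  filter_upwards [(T.cell_ae_eq_box x).mem_iff] with y hy hyc j
  rw [hy, h2] at hyc
  have e : ((1 : ℝ) / 4) ^ T.cuts 0 1 x j = (hi j - lo j) ^ 2 := by
    rw [h3]; simp only [Pi.one_apply, Pi.zero_apply, sub_zero, one_mul]
    rw [← pow_mul, mul_comm, pow_mul]; norm_num
  rw [e]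
  have a := hyc j (mem_univ j)
  have b := h1 j (mem_univ j)
  exact sq_le_sq' (by linarith [a.1, b.2]) (by linarith [a.2, b.1])

end CutTree

/-! ### Mean squared error of a local average -/

/-- This bounds 𝔼[1/(N+1)] for N binomial. By (n+1)·C(n,m) = (m+1)·C(n+1,m+1), multiplying by (n+1)v
gives the expansion of (v + (1-v))^{n+1} without its zeroth term. -/
theorem sum_finset_pow_mul_inv_card_succ_le {v : ℝ} (hv : 0 < v) (hv1 : v ≤ 1) (n : ℕ) :
    ∑ I : Finset (Fin n), v ^ I.card * (1 - v) ^ (n - I.card) * (1 / ((I.card : ℝ) + 1))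
      ≤ 1 / ((n + 1) * v) := by
  have h1 : ∑ I : Finset (Fin n), v ^ I.card * (1 - v) ^ (n - I.card) * (1 / ((I.card : ℝ) + 1))
      = ∑ m ∈ Finset.range (n + 1),
        (n.choose m : ℝ) * (v ^ m * (1 - v) ^ (n - m) * (1 / ((m : ℝ) + 1))) := by
    have := Finset.sum_powerset_apply_card
      (fun m => v ^ m * (1 - v) ^ (n - m) * (1 / ((m : ℝ) + 1))) (x := (Finset.univ : Finset (Fin n)))
    simpa using this
  have h2 := add_pow v (1 - v) (n + 1)
  rw [add_sub_cancel, one_pow, Finset.sum_range_succ'] at h2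
  rw [h1, le_div_iff₀ (by positivity), Finset.sum_mul]
  have h3 : 0 ≤ v ^ 0 * (1 - v) ^ (n + 1 - 0) * ((n + 1).choose 0 : ℝ) := by
    have := sub_nonneg.2 hv1
    positivity
  refine le_trans (le_of_eq ?_) ((le_add_of_nonneg_right h3).trans_eq h2.symm)
  refine Finset.sum_congr rfl fun m _ => ?_
  have h4 : ((n : ℝ) + 1) * n.choose m = (n + 1).choose (m + 1) * ((m : ℝ) + 1) := by
    exact_mod_cast Nat.add_one_mul_choose_eq n m
  have h5 : ((n : ℝ) + 1) * n.choose m / ((m : ℝ) + 1) = (n + 1).choose (m + 1) := by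
    rw [h4]; field_simp
  rw [← h5, Nat.add_sub_add_right, pow_succ]
  field_simp

section LocalAverage

variable {Ω : Type*} {n : ℕ}

/-- The indicator of the event that `I` is the set of indices of the points that lie in `B`. -/
noncomputable def exactIndicator (B : Set Ω) (I : Finset (Fin n)) (D : Fin n → Ω) : ℝ :=
  ∏ k, if k ∈ I then B.indicator (fun _ => 1) (D k) else Bᶜ.indicator (fun _ => 1) (D k)

open Classical in
theorem exactIndicator_eq (B : Set Ω) (I : Finset (Fin n)) (D : Fin n → Ω) :
    exactIndicator B I D = if I = Finset.univ.filter (fun k => D k ∈ B) then 1 else 0 := by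
  unfold exactIndicator
  split_ifs with h
  · refine Finset.prod_eq_one fun k _ => ?_
    by_cases hk : D k ∈ B <;> simp [h, hk]
  · rw [Finset.prod_eq_zero_iff]
    by_contra! hne
    apply h
    ext k
    have := hne k (Finset.mem_univ k)
    by_cases hk : k ∈ I <;> by_cases hB : D k ∈ B <;> simp_all

open Classical in
/-- The squared error, for estimating `t`, of the average of `Y` over the sample points that fall
in `B`, with the convention that this average is `0` when there is no such point. -/
theorem sq_average_sub_eq (B : Set Ω) (Y : Ω → ℝ) (t : ℝ) (D : Fin n → Ω) :
    ((if ∑ i, B.indicator (fun _ => (1 : ℝ)) (D i) = 0 then 0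
      else (∑ i, B.indicator Y (D i)) / ∑ i, B.indicator (fun _ => (1 : ℝ)) (D i)) - t) ^ 2
    = (∑ I : Finset (Fin n), 1 / (I.card : ℝ) ^ 2 * ∑ i ∈ I, ∑ j ∈ I,
        exactIndicator B I D * ((Y (D i) - t) * (Y (D j) - t)))
      + t ^ 2 * exactIndicator B ∅ D := by
  set I₀ := Finset.univ.filter (fun k => D k ∈ B) with hI
  have hcard : ∑ i, B.indicator (fun _ => (1 : ℝ)) (D i) = I₀.card := by
    simp [indicator_apply, hI]
  have hsum : ∑ i, B.indicator Y (D i) = ∑ i ∈ I₀, Y (D i) := by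
    simp [indicator_apply, hI, Finset.sum_filter]
  -- For a given sample, only the actual index set of the points in `B` has a nonzero indicator.
  rw [hcard, hsum, Finset.sum_eq_single I₀]
  rotate_left
  · intro I _ hne
    simp [exactIndicator_eq, ← hI, hne]
  · simp
  rw [exactIndicator_eq, exactIndicator_eq, ← hI, if_pos rfl]
  rcases I₀.eq_empty_or_nonempty with h | h
  · simp [h]
  · have hc : (I₀.card : ℝ) ≠ 0 := by exact_mod_cast h.card_pos.ne'
    rw [if_neg hc, if_neg h.ne_empty.symm]
    simp only [one_mul, ← Finset.mul_sum, ← Finset.sum_mul, Finset.sum_sub_distrib,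
      Finset.sum_const, nsmul_eq_mul]
    field_simp
    ring

variable [MeasurableSpace Ω]

/-- By independence the integrand is a product of functions of the single observations. Each index
contributes the probability of `B` or of its complement, and i, j contribute in addition moments of
`U` conditional on `B`. -/
theorem integral_exactIndicator_mul (P : Measure Ω) [IsProbabilityMeasure P] {B : Set Ω}
    (hB : MeasurableSet B) (hB0 : P.real B ≠ 0) {U : Ω → ℝ} (hU : MemLp U 2 P)
    {I : Finset (Fin n)} {i j : Fin n} (hi : i ∈ I) (hj : j ∈ I) :
    Integrable (fun D => exactIndicator B I D * (U (D i) * U (D j))) (Measure.pi fun _ => P) ∧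
    ∫ D, exactIndicator B I D * (U (D i) * U (D j)) ∂(Measure.pi fun _ => P) =
      P.real B ^ I.card * (1 - P.real B) ^ (n - I.card) *
        (if i = j then (∫ ω in B, U ω ^ 2 ∂P) / P.real B
          else ((∫ ω in B, U ω ∂P) / P.real B) ^ 2) := by
  have hU1 : Integrable U P := hU.integrable one_le_two
  have hU2 : Integrable (fun ω => U ω * U ω) P := by
    simpa only [sq] using hU.integrable_sq
  set f : Fin n → Ω → ℝ := fun k ω => (if k = i then U ω else 1) * (if k = j then U ω else 1)
    with hf
  have hfi : ∀ k, Integrable (f k) P := by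
    intro k
    simp only [hf]
    split_ifs <;> simp [hU1, hU2]
  set g : Fin n → Ω → ℝ := fun k ω => if k ∈ I then B.indicator (f k) ω else Bᶜ.indicator (f k) ω
    with hg
  have hgi : ∀ k, Integrable (g k) P := by
    intro k
    by_cases hk : k ∈ I
    · simpa [hg, hk] using (hfi k).indicator hB
    · simpa [hg, hk] using (hfi k).indicator hB.compl
  have heq : (fun D : Fin n → Ω => exactIndicator B I D * (U (D i) * U (D j)))
      = fun D => ∏ k, g k (D k) := by
    ext D
    have h1 : U (D i) = ∏ k, if k = i then U (D k) else 1 := by simp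
    have h2 : U (D j) = ∏ k, if k = j then U (D k) else 1 := by simp
    rw [h1, h2, exactIndicator, ← Finset.prod_mul_distrib, ← Finset.prod_mul_distrib]
    refine Finset.prod_congr rfl fun k _ => ?_
    by_cases hk : k ∈ I <;> by_cases hkB : D k ∈ B <;> simp [hg, hk, hkB, hf]
  rw [heq]
  refine ⟨Integrable.fintype_prod hgi, ?_⟩
  rw [integral_fintype_prod_eq_prod]
  have hconst : ∏ k : Fin n, (if k ∈ I then P.real B else 1 - P.real B)
      = P.real B ^ I.card * (1 - P.real B) ^ (n - I.card) := by
    rw [Finset.prod_ite, Finset.prod_const, Finset.prod_const]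
    congr 2
    · simp
    · rw [Finset.filter_not, Finset.card_sdiff_of_subset (Finset.filter_subset _ _)]
      simp
  have hBc : P.real Bᶜ = 1 - P.real B := probReal_compl_eq_one_sub hB
  rw [← hconst]
  by_cases hij : i = j
  · subst hij
    have h3 : (∫ ω in B, U ω ^ 2 ∂P) / P.real B
        = ∏ k, if k = i then (∫ ω in B, U ω ^ 2 ∂P) / P.real B else 1 := by simp
    rw [if_pos rfl, h3, ← Finset.prod_mul_distrib]
    refine Finset.prod_congr rfl fun k _ => ?_
    by_cases hki : k = i
    · subst hki
      simp only [hg, hi, if_true, integral_indicator hB, hf, ← sq]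
      field_simp
    · by_cases hk : k ∈ I
      · simp [hg, hk, integral_indicator hB, hf, hki]
      · simp [hg, hk, integral_indicator hB.compl, hf, hki, hBc]
  · have h3 : ∀ l : Fin n, (∫ ω in B, U ω ∂P) / P.real B
        = ∏ k, if k = l then (∫ ω in B, U ω ∂P) / P.real B else 1 := fun l => by simp
    have h4 : ((∫ ω in B, U ω ∂P) / P.real B) ^ 2
        = (∏ k, if k = i then (∫ ω in B, U ω ∂P) / P.real B else 1)
          * ∏ k, if k = j then (∫ ω in B, U ω ∂P) / P.real B else 1 := by
      rw [← h3 i, ← h3 j, sq]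
    rw [if_neg hij, h4, ← Finset.prod_mul_distrib, ← Finset.prod_mul_distrib]
    refine Finset.prod_congr rfl fun k _ => ?_
    by_cases hki : k = i
    · subst hki
      simp only [hg, hi, if_true, integral_indicator hB, hf, hij, if_false, mul_one]
      field_simp
    · by_cases hkj : k = j
      · subst hkj
        simp only [hg, hj, if_true, integral_indicator hB, hf, hki, if_false, one_mul]
        field_simp
      · by_cases hk : k ∈ I
        · simp [hg, hk, integral_indicator hB, hf, hki, hkj]
        · simp [hg, hk, integral_indicator hB.compl, hf, hki, hkj, hBc]

theorem integral_exactIndicator_empty (P : Measure Ω) [IsProbabilityMeasure P] {B : Set Ω}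
    (hB : MeasurableSet B) :
    Integrable (fun D : Fin n → Ω => exactIndicator B ∅ D) (Measure.pi fun _ => P) ∧
    ∫ D : Fin n → Ω, exactIndicator B ∅ D ∂(Measure.pi fun _ => P) = (1 - P.real B) ^ n := by
  have heq : (fun D : Fin n → Ω => exactIndicator B ∅ D)
      = fun D => ∏ k, Bᶜ.indicator (fun _ => (1 : ℝ)) (D k) := by
    ext D; simp [exactIndicator]
  rw [heq]
  refine ⟨Integrable.fintype_prod fun _ => (integrable_const _).indicator hB.compl, ?_⟩
  rw [integral_fintype_prod_eq_pow]
  simp [integral_indicator hB.compl, probReal_compl_eq_one_sub hB]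

-- Given that m ≥ 1 points fall in `B`, the m diagonal terms are at most σ² + δ and the others at
-- most δ, so the error is at most σ²/m + δ. The term in `t ^ 2` is the empty cell.
open Classical in
theorem lintegral_sq_average_sub_le (P : Measure Ω) [IsProbabilityMeasure P] {B : Set Ω}
    (hB : MeasurableSet B) (hB0 : 0 < P.real B) {Y : Ω → ℝ} (hY : MemLp Y 2 P) {t σ2 δ : ℝ}
    (hσ : 0 ≤ σ2) (hδ : 0 ≤ δ)
    (hmean : (∫ ω in B, (Y ω - t) ∂P) ^ 2 ≤ δ * P.real B ^ 2)
    (hsq : ∫ ω in B, (Y ω - t) ^ 2 ∂P ≤ (σ2 + δ) * P.real B) (n : ℕ) :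
    ∫⁻ D : Fin n → Ω, ENNReal.ofReal
      (((if ∑ i, B.indicator (fun _ => (1 : ℝ)) (D i) = 0 then 0
        else (∑ i, B.indicator Y (D i)) / ∑ i, B.indicator (fun _ => (1 : ℝ)) (D i)) - t) ^ 2)
      ∂(Measure.pi fun _ => P)
    ≤ ENNReal.ofReal (2 * σ2 / ((n + 1) * P.real B) + δ + t ^ 2 * (1 - P.real B) ^ n) := by
  have hU : MemLp (fun ω => Y ω - t) 2 P := hY.sub (memLp_const t)
  set v := P.real B with hv
  have hv1 : v ≤ 1 := measureReal_le_one
  have hint : ∀ I : Finset (Fin n), ∀ i ∈ I, ∀ j ∈ I, _ := fun I i hi j hj =>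
    integral_exactIndicator_mul (n := n) P hB hB0.ne' hU hi hj
  have hempty := integral_exactIndicator_empty (n := n) P hB
  have hI2 : ∀ I : Finset (Fin n), Integrable (fun D : Fin n → Ω =>
      1 / (I.card : ℝ) ^ 2 * ∑ i ∈ I, ∑ j ∈ I,
        exactIndicator B I D * ((Y (D i) - t) * (Y (D j) - t))) (Measure.pi fun _ => P) :=
    fun I => (integrable_finsetSum _ fun i hi => integrable_finsetSum _ fun j hj =>
      (hint I i hi j hj).1).const_mul _
  have hI1 := integrable_finsetSum Finset.univ fun I (_ : I ∈ Finset.univ) => hI2 I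
  have hI3 := hempty.1.const_mul (t ^ 2)
  rw [← ofReal_integral_eq_lintegral_ofReal]
  rotate_left
  · simp only [sq_average_sub_eq]
    exact hI1.add hI3
  · exact ae_of_all _ fun D => sq_nonneg _
  refine ENNReal.ofReal_le_ofReal ?_
  simp only [sq_average_sub_eq]
  rw [integral_add hI1 hI3, integral_const_mul, hempty.2, integral_finsetSum _ fun I _ => hI2 I]
  gcongr ?_ + _
  have hw : 0 ≤ 1 - v := sub_nonneg.2 hv1
  have hbound : ∀ I : Finset (Fin n), ∫ D : Fin n → Ω, 1 / (I.card : ℝ) ^ 2 * ∑ i ∈ I, ∑ j ∈ I,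
        exactIndicator B I D * ((Y (D i) - t) * (Y (D j) - t)) ∂(Measure.pi fun _ => P)
      ≤ 2 * σ2 * (v ^ I.card * (1 - v) ^ (n - I.card) * (1 / ((I.card : ℝ) + 1)))
        + δ * (v ^ I.card * (1 - v) ^ (n - I.card)) := by
    intro I
    rw [integral_const_mul, integral_finsetSum _ fun i hi => integrable_finsetSum _ fun j hj =>
      (hint I i hi j hj).1]
    have h1 : ∀ i ∈ I, ∫ D : Fin n → Ω, ∑ j ∈ I,
        exactIndicator B I D * ((Y (D i) - t) * (Y (D j) - t)) ∂(Measure.pi fun _ => P)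
        ≤ v ^ I.card * (1 - v) ^ (n - I.card) * (σ2 + I.card * δ) := by
      intro i hi
      rw [integral_finsetSum _ fun j hj => (hint I i hi j hj).1]
      have h2 : ∀ j ∈ I, ∫ D : Fin n → Ω,
          exactIndicator B I D * ((Y (D i) - t) * (Y (D j) - t)) ∂(Measure.pi fun _ => P)
          ≤ v ^ I.card * (1 - v) ^ (n - I.card) * ((if i = j then σ2 else 0) + δ) := by
        intro j hj
        rw [(hint I i hi j hj).2]
        gcongr
        split_ifs
        · rwa [div_le_iff₀ hB0]
        · rw [div_pow, div_le_iff₀ (by positivity), zero_add]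
          exact hmean
      refine (Finset.sum_le_sum h2).trans_eq ?_
      rw [← Finset.mul_sum, Finset.sum_add_distrib, Finset.sum_ite_eq, if_pos hi,
        Finset.sum_const, nsmul_eq_mul]
    have h3 := Finset.sum_le_sum h1
    rw [Finset.sum_const, nsmul_eq_mul] at h3
    refine (mul_le_mul_of_nonneg_left h3 (by positivity)).trans ?_
    have hA : 0 ≤ v ^ I.card * (1 - v) ^ (n - I.card) := by positivity
    set A := v ^ I.card * (1 - v) ^ (n - I.card)
    rcases I.eq_empty_or_nonempty with h | h
    · simp only [h, Finset.card_empty, Nat.cast_zero]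
      norm_num
      positivity
    · have hc : (1 : ℝ) ≤ I.card := by exact_mod_cast h.card_pos
      set m := (I.card : ℝ)
      -- Replacing 1/m by 2/(m+1) makes the binomial sum computable; this is the factor 2 in the
      -- variance term.
      have e : 1 / m ^ 2 * (m * (A * (σ2 + m * δ))) = A * σ2 * (1 / m) + δ * A := by
        field_simp
      have e2 : 1 / m ≤ 2 * (1 / (m + 1)) := by
        rw [mul_one_div, div_le_div_iff₀ (by positivity) (by positivity)]
        linarith
      rw [e]
      have := mul_le_mul_of_nonneg_left e2 (mul_nonneg hA hσ)
      linarith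
  refine (Finset.sum_le_sum fun I _ => hbound I).trans ?_
  rw [Finset.sum_add_distrib, ← Finset.mul_sum, ← Finset.mul_sum]
  have hone := Fintype.sum_pow_mul_eq_add_pow (Fin n) v (1 - v)
  rw [Fintype.card_fin, add_sub_cancel, one_pow] at hone
  rw [hone, mul_one]
  have := mul_le_mul_of_nonneg_left (sum_finset_pow_mul_inv_card_succ_le hB0 hv1 n)
    (mul_nonneg zero_le_two hσ)
  rw [mul_one_div] at this
  linarith

end LocalAverage

/-- As `B` is `m`-measurable, `Y` and `Y ^ 2` may be replaced by their conditional expectations;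
then 𝔼[(Y-t)² | m] is the conditional variance plus (𝔼[Y | m] - t)². -/
theorem setIntegral_sub_moments_le {Ω : Type*} {m m0 : MeasurableSpace Ω} (hm : m ≤ m0)
    (P : Measure Ω) [IsProbabilityMeasure P] {B : Set Ω} (hB : MeasurableSet[m] B) {Y : Ω → ℝ}
    (hY : MemLp Y 2 P) {t σ2 δ : ℝ} (hδ : 0 ≤ δ) (hvar : Var[Y; P | m] ≤ᵐ[P] fun _ => σ2)
    (hmean : ∀ᵐ ω ∂P, ω ∈ B → ((P[Y | m]) ω - t) ^ 2 ≤ δ) :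
    (∫ ω in B, (Y ω - t) ∂P) ^ 2 ≤ δ * P.real B ^ 2 ∧
    ∫ ω in B, (Y ω - t) ^ 2 ∂P ≤ (σ2 + δ) * P.real B := by
  have hB0 : MeasurableSet B := hm B hB
  have hY1 : Integrable Y P := hY.integrable one_le_two
  have hY2 : Integrable (Y ^ 2) P := hY.integrable_sq
  have hmB : ∀ᵐ ω ∂P.restrict B, ((P[Y | m]) ω - t) ^ 2 ≤ δ :=
    (ae_restrict_iff' hB0).2 hmean
  constructor
  · have h1 : ∫ ω in B, (Y ω - t) ∂P = ∫ ω in B, ((P[Y | m]) ω - t) ∂P := by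
      rw [integral_sub hY1.integrableOn (integrable_const _).integrableOn,
        integral_sub integrable_condExp.integrableOn (integrable_const _).integrableOn,
        setIntegral_condExp hm hY1 hB]
    have h2 : ‖∫ ω in B, ((P[Y | m]) ω - t) ∂P‖ ≤ √δ * P.real B := by
      refine norm_setIntegral_le_of_norm_le_const_ae (measure_lt_top P B) ?_
      filter_upwards [hmB] with ω hω
      exact Real.abs_le_sqrt hω
    rw [h1, ← sq_abs, ← Real.norm_eq_abs]
    refine (pow_le_pow_left₀ (norm_nonneg _) h2 2).trans_eq ?_
    rw [mul_pow, Real.sq_sqrt hδ]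
  · have h1 : ∫ ω in B, (Y ω - t) ^ 2 ∂P
        = ∫ ω in B, ((P[Y ^ 2 | m]) ω - 2 * t * (P[Y | m]) ω + t ^ 2) ∂P := by
      have e : ∀ ω, (Y ω - t) ^ 2 = (Y ^ 2) ω - 2 * t * Y ω + t ^ 2 := fun ω => by
        simp only [Pi.pow_apply]; ring
      have key : ∀ f g : Ω → ℝ, Integrable f P → Integrable g P →
          ∫ ω in B, (f ω - 2 * t * g ω + t ^ 2) ∂P
            = ∫ ω in B, f ω ∂P - 2 * t * ∫ ω in B, g ω ∂P + ∫ _ in B, t ^ 2 ∂P := by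
        intro f g hf hg
        have hg' : Integrable (fun ω => 2 * t * g ω) P := hg.const_mul _
        have hfg : Integrable (fun ω => f ω - 2 * t * g ω) P := hf.sub hg'
        rw [integral_add hfg.integrableOn (integrable_const _).integrableOn,
          integral_sub hf.integrableOn hg'.integrableOn, integral_const_mul]
      simp only [e]
      rw [key _ _ hY2 hY1, key _ _ integrable_condExp integrable_condExp,
        setIntegral_condExp hm hY1 hB, setIntegral_condExp hm hY2 hB]
    rw [h1]
    have h2 : ∫ _ in B, (σ2 + δ) ∂P = (σ2 + δ) * P.real B := by
      rw [setIntegral_const, smul_eq_mul, mul_comm]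
    rw [← h2]
    refine integral_mono_ae ((integrable_condExp.sub (integrable_condExp.const_mul _)).add
      (integrable_const _)).integrableOn (integrable_const _).integrableOn ?_
    filter_upwards [hmB, ae_restrict_of_ae hvar,
      ae_restrict_of_ae (condVar_ae_eq_condExp_sq_sub_sq_condExp hm hY)] with ω h3 h4 h5
    simp only [Pi.sub_apply, Pi.pow_apply] at h5
    rw [h5] at h4
    nlinarith

/-! ### Risk bound for a distribution in the class -/

section Smooth

variable {d : ℕ} {𝒮 : Finset (Fin d)} {L σ2 : ℝ} {P : Measure ((Fin d → ℝ) × ℝ)}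
  {rs : (𝒮 → ℝ) → ℝ}

theorem IsSmooth.continuousOn (h : IsSmooth 𝒮 L σ2 P rs) : ContinuousOn rs (Icc 0 1) := by
  intro v hv
  rw [ContinuousWithinAt, tendsto_iff_dist_tendsto_zero]
  have hc : Continuous fun u : 𝒮 → ℝ => L * √(∑ j, (u j - v j) ^ 2) := by fun_prop
  have h0 : Tendsto (fun u : 𝒮 → ℝ => L * √(∑ j, (u j - v j) ^ 2)) (𝓝[Icc 0 1] v) (𝓝 0) := by
    have := hc.tendsto v
    simp only [sub_self, ne_eq, OfNat.ofNat_ne_zero, not_false_eq_true, zero_pow,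
      Finset.sum_const_zero, Real.sqrt_zero, mul_zero] at this
    exact this.mono_left nhdsWithin_le_nhds
  refine squeeze_zero' (Eventually.of_forall fun _ => dist_nonneg) ?_ h0
  filter_upwards [self_mem_nhdsWithin] with u hu
  exact h.lipschitz u hu v hv

/-- The extension to the whole space, through the projection onto the cube, of the function on
the cube with section `rs`. -/
noncomputable def clampedLift (rs : (𝒮 → ℝ) → ℝ) (x : Fin d → ℝ) : ℝ :=
  rs fun j => max 0 (min 1 (x j))

theorem clampedLift_eq (rs : (𝒮 → ℝ) → ℝ) {x : Fin d → ℝ} (hx : x ∈ Icc (0 : Fin d → ℝ) 1) :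
    clampedLift rs x = lift rs x := by
  unfold clampedLift lift
  congr 1
  ext j
  have h0 : 0 ≤ x j := hx.1 j
  have h1 : x j ≤ 1 := hx.2 j
  rw [min_eq_right h1, max_eq_right h0]

theorem IsSmooth.continuous_clampedLift (h : IsSmooth 𝒮 L σ2 P rs) :
    Continuous (clampedLift rs) := by
  refine h.continuousOn.comp_continuous (by fun_prop) fun x => ⟨fun j => ?_, fun j => ?_⟩
  · exact le_max_left _ _
  · exact max_le zero_le_one (min_le_left _ _)

theorem IsSmooth.sq_le_iSup (h : IsSmooth 𝒮 L σ2 P rs) {x : Fin d → ℝ}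
    (hx : x ∈ Icc (0 : Fin d → ℝ) 1) :
    lift rs x ^ 2 ≤ ⨆ y : Icc (0 : Fin d → ℝ) 1, lift rs y ^ 2 := by
  have hc : Continuous fun y : Icc (0 : Fin d → ℝ) 1 => lift rs y ^ 2 := by
    have : (fun y : Icc (0 : Fin d → ℝ) 1 => lift rs y ^ 2)
        = fun y : Icc (0 : Fin d → ℝ) 1 => clampedLift rs y ^ 2 := by
      ext y; rw [clampedLift_eq rs y.2]
    rw [this]
    exact (h.continuous_clampedLift.comp continuous_subtype_val).pow 2
  -- Compactness matters: an unbounded real supremum would default to 0.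
  exact le_ciSup (isCompact_range hc).bddAbove ⟨x, hx⟩

theorem IsSmooth.sq_sub_le (h : IsSmooth 𝒮 L σ2 P rs) {x y : Fin d → ℝ}
    (hx : x ∈ Icc (0 : Fin d → ℝ) 1) (hy : y ∈ Icc (0 : Fin d → ℝ) 1) :
    (lift rs y - lift rs x) ^ 2 ≤ L ^ 2 * ∑ j ∈ 𝒮, (y j - x j) ^ 2 := by
  have := h.lipschitz (fun j => y j) ⟨fun j => hy.1 j, fun j => hy.2 j⟩
    (fun j => x j) ⟨fun j => hx.1 j, fun j => hx.2 j⟩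
  rw [← sq_abs]
  refine (pow_le_pow_left₀ (abs_nonneg _) this 2).trans_eq ?_
  rw [mul_pow, Real.sq_sqrt (Finset.sum_nonneg fun _ _ => sq_nonneg _),
    Finset.sum_coe_sort 𝒮 fun j => (y j - x j) ^ 2]

theorem IsSmooth.ae_fst (h : IsSmooth 𝒮 L σ2 P rs) {p : (Fin d → ℝ) → Prop}
    (hp : ∀ᵐ x : Fin d → ℝ, p x) : ∀ᵐ z ∂P, p z.1 := by
  have : ∀ᵐ x ∂(P.map Prod.fst), p x := by
    rw [h.uniform]
    exact ae_restrict_of_ae hp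
  exact ae_of_ae_map measurable_fst.aemeasurable this

theorem IsSmooth.ae_fst_mem_Icc (h : IsSmooth 𝒮 L σ2 P rs) :
    ∀ᵐ z ∂P, z.1 ∈ Icc (0 : Fin d → ℝ) 1 := by
  have : ∀ᵐ x ∂(P.map Prod.fst), x ∈ Icc (0 : Fin d → ℝ) 1 := by
    rw [h.uniform]
    exact ae_restrict_mem measurableSet_Icc
  exact ae_of_ae_map measurable_fst.aemeasurable this

theorem IsSmooth.ae_fst_mem_box (h : IsSmooth 𝒮 L σ2 P rs) :
    ∀ᵐ z ∂P, z.1 ∈ univ.pi fun j => Ico ((0 : Fin d → ℝ) j) ((1 : Fin d → ℝ) j) := by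
  have h1 : ∀ᵐ x : Fin d → ℝ, (x ∈ univ.pi fun j => Ico ((0 : Fin d → ℝ) j) ((1 : Fin d → ℝ) j))
      ↔ x ∈ Icc (0 : Fin d → ℝ) 1 :=
    (Measure.univ_pi_Ico_ae_eq_Icc (μ := fun _ : Fin d => (volume : Measure ℝ))
      (f := 0) (g := 1)).mem_iff
  filter_upwards [h.ae_fst h1, h.ae_fst_mem_Icc] with z h2 h3 using h2.2 h3

theorem IsSmooth.measureReal_cell (h : IsSmooth 𝒮 L σ2 P rs) {K : ℕ} (T : CutTree d K)
    {x : Fin d → ℝ}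
    (hx : x ∈ univ.pi fun j => Ico ((0 : Fin d → ℝ) j) ((1 : Fin d → ℝ) j)) :
    P.real (Prod.fst ⁻¹' T.cell x) = (1 / 2) ^ K := by
  rw [measureReal_def, ← Measure.map_apply measurable_fst (T.measurableSet_cell x), h.uniform,
    Measure.restrict_apply (T.measurableSet_cell x), CutTree.cell,
    inter_eq_self_of_subset_left inter_subset_left, ← CutTree.cell, T.volume_cell hx,
    ENNReal.toReal_ofReal (by positivity)]

theorem IsSmooth.lintegral_sq_estimate_sub_le (h : IsSmooth 𝒮 L σ2 P rs) (hσ : 0 ≤ σ2)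
    {K : ℕ} (T : CutTree d K) (n : ℕ) {x : Fin d → ℝ}
    (hx : x ∈ univ.pi fun j => Ico ((0 : Fin d → ℝ) j) ((1 : Fin d → ℝ) j)) :
    ∫⁻ D : Fin n → (Fin d → ℝ) × ℝ, ENNReal.ofReal ((T.estimate D x - lift rs x) ^ 2)
      ∂(Measure.pi fun _ => P)
    ≤ ENNReal.ofReal (2 * σ2 / ((n + 1) * (1 / 2) ^ K)
      + L ^ 2 * ∑ j ∈ 𝒮, (1 / 4) ^ T.cuts 0 1 x j
      + lift rs x ^ 2 * (1 - (1 / 2) ^ K) ^ n) := by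
  have := h.isProb
  have hxI : x ∈ Icc (0 : Fin d → ℝ) 1 :=
    ⟨fun j => (hx j (mem_univ j)).1, fun j => (hx j (mem_univ j)).2.le⟩
  have hv := h.measureReal_cell T hx
  have hδ : 0 ≤ L ^ 2 * ∑ j ∈ 𝒮, ((1 : ℝ) / 4) ^ T.cuts 0 1 x j := by positivity
  have hmean : ∀ᵐ z ∂P, z ∈ Prod.fst ⁻¹' T.cell x →
      ((P[fun z => z.2 | MeasurableSpace.comap Prod.fst inferInstance]) z - lift rs x) ^ 2
        ≤ L ^ 2 * ∑ j ∈ 𝒮, ((1 : ℝ) / 4) ^ T.cuts 0 1 x j := by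
    filter_upwards [h.regression, h.ae_fst (T.ae_sq_sub_le_of_mem_cell hx),
      h.ae_fst_mem_Icc] with z h1 h2 h3 hz
    rw [h1]
    refine (h.sq_sub_le hxI h3).trans ?_
    gcongr with j _
    exact h2 hz j
  obtain ⟨h1, h2⟩ := setIntegral_sub_moments_le measurable_fst.comap_le P
    (B := Prod.fst ⁻¹' T.cell x) ⟨_, T.measurableSet_cell x, rfl⟩ h.memLp hδ h.variance_le hmean
  have := lintegral_sq_average_sub_le P (measurable_fst (T.measurableSet_cell x))
    (by rw [hv]; positivity) h.memLp hσ hδ h1 h2 n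
  rw [hv] at this
  refine le_trans (le_of_eq ?_) this
  refine lintegral_congr fun D => ?_
  unfold CutTree.estimate CutTree.count
  congr!

theorem sq_forest_sub_le {n : ℕ} {q : Fin d → ℝ} (hq : ∀ j, 0 ≤ q j) (hq1 : ∑ j, q j = 1)
    (k : ℝ) (D : Fin n → (Fin d → ℝ) × ℝ) (x : Fin d → ℝ) (t : ℝ) :
    (forest q k D x - t) ^ 2
      ≤ ∑ T : CutTree d ⌈Real.logb 2 k⌉₊, T.prob q * (T.estimate D x - t) ^ 2 := by
  have h1 := CutTree.sum_prob hq1 ⌈Real.logb 2 k⌉₊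
  have e : forest q k D x - t
      = ∑ T : CutTree d ⌈Real.logb 2 k⌉₊, T.prob q • (T.estimate D x - t) := by
    simp only [smul_eq_mul, mul_sub, Finset.sum_sub_distrib, ← Finset.sum_mul, h1, one_mul]
    rfl
  rw [e]
  exact (even_two.convexOn_pow (𝕜 := ℝ)).map_sum_le (fun T _ => T.prob_nonneg hq) h1
    fun _ _ => mem_univ _

theorem measurable_forest {α : Type*} [MeasurableSpace α] {n : ℕ} (q : Fin d → ℝ) (k : ℝ)
    {D : α → Fin n → (Fin d → ℝ) × ℝ} (hD : Measurable D) {x : α → Fin d → ℝ}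
    (hx : Measurable x) : Measurable fun a => forest q k (D a) (x a) := by
  unfold forest
  refine Finset.measurable_sum _ fun T _ => Measurable.const_mul ?_ _
  have h := (T.measurable_estimate n).comp (hD.prodMk hx)
  exact h

theorem IsSmooth.risk_le (h : IsSmooth 𝒮 L σ2 P rs) (hσ : 0 ≤ σ2) {q : Fin d → ℝ}
    (hq : ∀ j, 0 ≤ q j) (hq1 : ∑ j, q j = 1) (n : ℕ) (k : ℝ) :
    risk n q k P (lift rs) ≤ ENNReal.ofReal
      (2 * σ2 / ((n + 1) * (1 / 2) ^ ⌈Real.logb 2 k⌉₊)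
      + L ^ 2 * ∑ j ∈ 𝒮, (1 - 3 / 4 * q j) ^ ⌈Real.logb 2 k⌉₊
      + (⨆ y : Icc (0 : Fin d → ℝ) 1, lift rs y ^ 2)
        * (1 - (1 / 2) ^ ⌈Real.logb 2 k⌉₊) ^ n) := by
  have := h.isProb
  have hpi : SigmaFinite (Measure.pi fun _ : Fin n => P) := inferInstance
  have : SFinite (Measure.pi fun _ : Fin n => P) := instSFiniteOfSigmaFinite
  set K := ⌈Real.logb 2 k⌉₊ with hK
  have hw : (0 : ℝ) ≤ 1 - (1 / 2) ^ K := sub_nonneg.2 (pow_le_one₀ (by norm_num) (by norm_num))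
  have hae : ∀ᵐ w ∂((Measure.pi fun _ : Fin n => P).prod P), w.2.1 ∈ Icc (0 : Fin d → ℝ) 1 :=
    Measure.quasiMeasurePreserving_snd.ae h.ae_fst_mem_Icc
  -- Nothing is assumed on `rs` off the cube, so `lift rs` may fail to be measurable. Tonelli is
  -- applied to its continuous clamped version, which agrees with it almost surely.
  have hmeas : Measurable fun w : (Fin n → (Fin d → ℝ) × ℝ) × ((Fin d → ℝ) × ℝ) =>
      ENNReal.ofReal ((forest q k w.1 w.2.1 - clampedLift rs w.2.1) ^ 2) := by
    have h1 : Measurable fun w : (Fin n → (Fin d → ℝ) × ℝ) × ((Fin d → ℝ) × ℝ) =>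
        forest q k w.1 w.2.1 :=
      measurable_forest q k measurable_fst (measurable_fst.comp measurable_snd)
    have h2 : Measurable fun w : (Fin n → (Fin d → ℝ) × ℝ) × ((Fin d → ℝ) × ℝ) =>
        clampedLift rs w.2.1 :=
      h.continuous_clampedLift.measurable.comp (measurable_fst.comp measurable_snd)
    exact ((h1.sub h2).pow_const 2).ennreal_ofReal
  have hsymm := lintegral_prod_symm' (μ := Measure.pi fun _ : Fin n => P) (ν := P) _ hmeas
  unfold risk
  rw [lintegral_congr_ae (g := fun w =>
    ENNReal.ofReal ((forest q k w.1 w.2.1 - clampedLift rs w.2.1) ^ 2))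
    (by filter_upwards [hae] with w hw; rw [clampedLift_eq rs hw]), hsymm]
  refine (lintegral_mono_ae (g := fun _ => ENNReal.ofReal _) ?_).trans_eq
    (by rw [lintegral_const, measure_univ, mul_one])
  filter_upwards [h.ae_fst_mem_box, h.ae_fst_mem_Icc] with z hz hzI
  rw [clampedLift_eq rs hzI]
  set x := z.1
  have hprob : ∀ T : CutTree d K, 0 ≤ T.prob q := fun T => T.prob_nonneg hq
  have hmeasT : ∀ T : CutTree d K, Measurable fun D : Fin n → (Fin d → ℝ) × ℝ =>
      ENNReal.ofReal ((T.estimate D x - lift rs x) ^ 2) := fun T =>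
    ((((T.measurable_estimate n).comp measurable_prodMk_right).sub_const _).pow_const
      2).ennreal_ofReal
  calc ∫⁻ D : Fin n → (Fin d → ℝ) × ℝ, ENNReal.ofReal ((forest q k D x - lift rs x) ^ 2)
        ∂(Measure.pi fun _ => P)
      ≤ ∫⁻ D : Fin n → (Fin d → ℝ) × ℝ, ∑ T : CutTree d K, ENNReal.ofReal (T.prob q)
          * ENNReal.ofReal ((T.estimate D x - lift rs x) ^ 2) ∂(Measure.pi fun _ => P) := by
        refine lintegral_mono fun D => ?_
        refine (ENNReal.ofReal_le_ofReal (sq_forest_sub_le hq hq1 k D x _)).trans_eq ?_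
        rw [ENNReal.ofReal_sum_of_nonneg fun T _ => mul_nonneg (hprob T) (sq_nonneg _)]
        exact Finset.sum_congr rfl fun T _ => ENNReal.ofReal_mul (hprob T)
    _ = ∑ T : CutTree d K, ENNReal.ofReal (T.prob q)
          * ∫⁻ D : Fin n → (Fin d → ℝ) × ℝ, ENNReal.ofReal ((T.estimate D x - lift rs x) ^ 2)
            ∂(Measure.pi fun _ => P) := by
        rw [lintegral_finsetSum _ fun T _ => (hmeasT T).const_mul _]
        exact Finset.sum_congr rfl fun T _ => lintegral_const_mul _ (hmeasT T)
    _ ≤ ∑ T : CutTree d K, ENNReal.ofReal (T.prob q * (2 * σ2 / ((n + 1) * (1 / 2) ^ K)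
          + L ^ 2 * ∑ j ∈ 𝒮, (1 / 4) ^ T.cuts 0 1 x j
          + lift rs x ^ 2 * (1 - (1 / 2) ^ K) ^ n)) := by
        refine Finset.sum_le_sum fun T _ => ?_
        rw [ENNReal.ofReal_mul (hprob T)]
        gcongr
        exact h.lintegral_sq_estimate_sub_le hσ T n hz
    _ = ENNReal.ofReal (2 * σ2 / ((n + 1) * (1 / 2) ^ K)
          + L ^ 2 * ∑ j ∈ 𝒮, (1 - 3 / 4 * q j) ^ K
          + lift rs x ^ 2 * (1 - (1 / 2) ^ K) ^ n) := by
        rw [← ENNReal.ofReal_sum_of_nonneg fun T _ => mul_nonneg (hprob T) (by positivity)]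
        congr 1
        simp only [mul_add, Finset.sum_add_distrib, ← Finset.sum_mul, CutTree.sum_prob hq1 K,
          one_mul]
        congr 2
        simp only [mul_left_comm _ (L ^ 2), ← Finset.mul_sum]
        congr 1
        simp only [Finset.mul_sum]
        rw [Finset.sum_comm]
        refine Finset.sum_congr rfl fun j _ => ?_
        rw [CutTree.sum_prob_mul_pow_cuts hq1]
        norm_num
    _ ≤ _ := by
        gcongr
        exact h.sq_le_iSup hzI

end Smooth

/-! ### The three risk terms as functions of k -/

section Depth

variable {k : ℝ}

theorem depth_eq_zero (hk0 : 0 ≤ k) (hk : k ≤ 1) : ⌈Real.logb 2 k⌉₊ = 0 :=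
  Nat.ceil_eq_zero.2 (Real.logb_nonpos one_lt_two hk0 hk)

theorem two_pow_depth_le (hk : 1 < k) : (2 : ℝ) ^ ⌈Real.logb 2 k⌉₊ ≤ 2 * k := by
  have h := (Nat.ceil_lt_add_one (Real.logb_nonneg one_lt_two hk.le)).le
  rw [← Real.rpow_natCast]
  refine (Real.rpow_le_rpow_of_exponent_le one_le_two h).trans_eq ?_
  rw [Real.rpow_add two_pos, Real.rpow_logb two_pos (by norm_num) (by linarith), Real.rpow_one,
    mul_comm]

/-- If k ≤ 1 there is no cut and the variance term need not be O(σ²k/n); it is then absorbed by L² ≤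
L²k^{-α}. -/
theorem variance_term_le (hk0 : 0 < k) {n : ℕ} (hn : 0 < n) {σ2 L α : ℝ} (hσ : 0 ≤ σ2)
    (hα : 0 ≤ α) (hL : 2 * σ2 / (n + 1) ≤ L ^ 2) :
    2 * σ2 / ((n + 1) * (1 / 2) ^ ⌈Real.logb 2 k⌉₊)
      ≤ 4 * σ2 * (k / n) + L ^ 2 * k ^ (-α) := by
  have hn' : (0 : ℝ) < n := by exact_mod_cast hn
  rcases le_or_gt k 1 with hk | hk
  · rw [depth_eq_zero hk0.le hk, pow_zero, mul_one]
    have h1 := Real.one_le_rpow_of_pos_of_le_one_of_nonpos hk0 hk (neg_nonpos.2 hα)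
    have h2 : L ^ 2 ≤ L ^ 2 * k ^ (-α) := le_mul_of_one_le_right (sq_nonneg L) h1
    have h3 : 0 ≤ 4 * σ2 * (k / n) := by positivity
    linarith
  · have h1 := two_pow_depth_le hk
    have h2 : 2 * σ2 / ((n + 1) * (1 / 2) ^ ⌈Real.logb 2 k⌉₊)
        = 2 * σ2 * 2 ^ ⌈Real.logb 2 k⌉₊ / (n + 1) := by
      rw [one_div, inv_pow]; field_simp
    have h3 : 2 * σ2 * 2 ^ ⌈Real.logb 2 k⌉₊ / (n + 1) ≤ 2 * σ2 * (2 * k) / n := by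
      gcongr; linarith
    have h4 : 0 ≤ L ^ 2 * k ^ (-α) := by positivity
    rw [h2]
    refine h3.trans ?_
    have h5 : 2 * σ2 * (2 * k) / n = 4 * σ2 * (k / n) := by ring
    linarith

/-- For k > 1, (1 - 3q/4)^K ≤ exp(-(3/4)q log₂ k) = k^{-α(1+ξ)}, and `hξ` says that the perturbation
k^{-αξ} costs at most a factor 2. -/
theorem bias_term_le (hk0 : 0 < k) {S q ξ : ℝ} (hS : 0 < S) (hq : q = 1 / S * (1 + ξ))
    (hq0 : 0 ≤ q) (hq1 : q ≤ 1)
    (hξ : 1 < k → 0.75 / (S * Real.log 2) * |ξ| * Real.log k ≤ Real.log 2) :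
    (1 - 3 / 4 * q) ^ ⌈Real.logb 2 k⌉₊ ≤ 2 * k ^ (-(0.75 / (S * Real.log 2))) := by
  have hlog : 0 < Real.log 2 := Real.log_pos one_lt_two
  rcases le_or_gt k 1 with hk | hk
  · rw [depth_eq_zero hk0.le hk, pow_zero]
    have := Real.one_le_rpow_of_pos_of_le_one_of_nonpos hk0 hk
      (neg_nonpos.2 (show 0 ≤ 0.75 / (S * Real.log 2) by positivity))
    linarith
  · have hlk : 0 < Real.log k := Real.log_pos hk
    calc (1 - 3 / 4 * q) ^ ⌈Real.logb 2 k⌉₊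
        ≤ Real.exp (-(3 / 4 * q)) ^ ⌈Real.logb 2 k⌉₊ :=
          pow_le_pow_left₀ (by linarith) (Real.one_sub_le_exp_neg _) _
      _ = Real.exp (-(3 / 4 * q) * ⌈Real.logb 2 k⌉₊) := by
          rw [← Real.exp_nat_mul, mul_comm]
      _ ≤ Real.exp (Real.log 2 + Real.log k * (-(0.75 / (S * Real.log 2)))) := by
          refine Real.exp_le_exp.2 ?_
          have h1 := mul_le_mul_of_nonneg_left (Nat.le_ceil (Real.logb 2 k))
            (show 0 ≤ 3 / 4 * q by positivity)
          have h2 : 3 / 4 * q * Real.logb 2 k = Real.log k * (0.75 / (S * Real.log 2))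
              + 0.75 / (S * Real.log 2) * ξ * Real.log k := by
            rw [hq, Real.logb]; field_simp; ring
          have h3 : -(0.75 / (S * Real.log 2) * ξ * Real.log k)
              ≤ 0.75 / (S * Real.log 2) * |ξ| * Real.log k := by
            have : -ξ ≤ |ξ| := neg_le_abs ξ
            have h4 : 0 ≤ 0.75 / (S * Real.log 2) * Real.log k := by positivity
            nlinarith
          have h4 := hξ hk
          linarith
      _ = 2 * k ^ (-(0.75 / (S * Real.log 2))) := by
          rw [Real.exp_add, Real.exp_log two_pos, Real.rpow_def_of_pos hk0]

/-- With no cut the term vanishes, because n > 0. Otherwise (1-v)^n ≤ e^{-nv} ≤ 1/(nv), and 1/v ≤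
2k. -/
theorem empty_cell_term_le (hk0 : 0 < k) {n : ℕ} (hn : 0 < n) :
    (1 - (1 / 2 : ℝ) ^ ⌈Real.logb 2 k⌉₊) ^ n ≤ 2 * (k / n) := by
  have hn' : (0 : ℝ) < n := by exact_mod_cast hn
  rcases le_or_gt k 1 with hk | hk
  · rw [depth_eq_zero hk0.le hk, pow_zero, sub_self, zero_pow hn.ne']
    positivity
  · have h1 := two_pow_depth_le hk
    set v := (1 / 2 : ℝ) ^ ⌈Real.logb 2 k⌉₊ with hv
    have hv0 : 0 < v := by positivity
    have hv1 : v ≤ 1 := pow_le_one₀ (by norm_num) (by norm_num)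
    have hvi : 1 / v ≤ 2 * k := by
      rw [hv, one_div_pow, one_div_one_div]; exact h1
    calc (1 - v) ^ n ≤ Real.exp (-v) ^ n :=
          pow_le_pow_left₀ (by linarith) (Real.one_sub_le_exp_neg _) _
      _ = (Real.exp (n * v))⁻¹ := by rw [← Real.exp_nat_mul, ← Real.exp_neg, mul_neg]
      _ ≤ (n * v)⁻¹ := by
          gcongr
          linarith [Real.add_one_le_exp (n * v)]
      _ = 1 / v / n := by field_simp
      _ ≤ 2 * k / n := by gcongr
      _ = 2 * (k / n) := by ring

end Depth

/-! ### Balancing with the chosen k, uniformly over the class -/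

section Constants

variable {S n : ℕ} {c L Ξ : ℝ}

theorem kChoice_pos (hc : 0 < c) (hL : 0 < L) (hΞ : 0 < Ξ) (hn : 0 < n) :
    0 < kChoice S c L Ξ n := by
  have : (0 : ℝ) < n := by exact_mod_cast hn
  unfold kChoice
  positivity

theorem rate_pos (hL : 0 < L) (hΞ : 0 < Ξ) (hn : 0 < n) : 0 < rate S L Ξ n := by
  have : (0 : ℝ) < n := by exact_mod_cast hn
  unfold rate
  positivity

theorem log_kChoice (hc : 0 < c) (hL : 0 < L) (hΞ : 0 < Ξ) (hn : 0 < n) :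
    Real.log (kChoice S c L Ξ n) = Real.log c
      + 1 / (1 + 0.75 / (S * Real.log 2)) * (2 * Real.log L - Real.log Ξ)
      + 1 / (1 + 0.75 / (S * Real.log 2)) * Real.log n := by
  have : (0 : ℝ) < n := by exact_mod_cast hn
  unfold kChoice
  rw [Real.log_mul (by positivity) (by positivity), Real.log_mul (by positivity) (by positivity),
    Real.log_rpow (by positivity), Real.log_rpow this, Real.log_div (by positivity) hΞ.ne',
    Real.log_pow]
  norm_num

theorem log_rate (hL : 0 < L) (hΞ : 0 < Ξ) (hn : 0 < n) :
    Real.log (rate S L Ξ n) = 0.75 / (S * Real.log 2 + 0.75)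
        * (Real.log Ξ + 2 * S * Real.log 2 / 0.75 * Real.log L)
      + -0.75 / (S * Real.log 2 + 0.75) * Real.log n := by
  have : (0 : ℝ) < n := by exact_mod_cast hn
  unfold rate
  rw [Real.log_mul (by positivity) (by positivity), Real.log_rpow (by positivity),
    Real.log_rpow this, Real.log_mul hΞ.ne' (by positivity), Real.log_rpow hL]

theorem Xi_mul_kChoice_div (hS : 0 < S) (hc : 0 < c) (hL : 0 < L) (hΞ : 0 < Ξ) (hn : 0 < n) :
    Ξ * (kChoice S c L Ξ n / n) = c * rate S L Ξ n := by
  have hn' : (0 : ℝ) < n := by exact_mod_cast hn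
  have hS' : (0 : ℝ) < S := by exact_mod_cast hS
  have hk := kChoice_pos (S := S) hc hL hΞ hn
  have hr := rate_pos (S := S) hL hΞ hn
  have hlog : 0 < Real.log 2 := Real.log_pos one_lt_two
  -- Taking logarithms turns the identity between real powers into a field identity.
  refine Real.log_injOn_pos (mem_Ioi.2 (by positivity)) (mem_Ioi.2 (by positivity)) ?_
  rw [Real.log_mul hΞ.ne' (by positivity), Real.log_div hk.ne' hn'.ne',
    Real.log_mul hc.ne' hr.ne', log_kChoice hc hL hΞ hn, log_rate hL hΞ hn]
  field_simp
  ring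

theorem sq_mul_kChoice_rpow (hS : 0 < S) (hc : 0 < c) (hL : 0 < L) (hΞ : 0 < Ξ) (hn : 0 < n) :
    L ^ 2 * kChoice S c L Ξ n ^ (-(0.75 / (S * Real.log 2)))
      = c ^ (-(0.75 / (S * Real.log 2))) * rate S L Ξ n := by
  have hS' : (0 : ℝ) < S := by exact_mod_cast hS
  have hk := kChoice_pos (S := S) hc hL hΞ hn
  have hr := rate_pos (S := S) hL hΞ hn
  have hlog : 0 < Real.log 2 := Real.log_pos one_lt_two
  refine Real.log_injOn_pos (mem_Ioi.2 (by positivity)) (mem_Ioi.2 (by positivity)) ?_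
  rw [Real.log_mul (by positivity) (by positivity), Real.log_rpow hk, Real.log_pow,
    Real.log_mul (by positivity) hr.ne', Real.log_rpow hc, log_kChoice hc hL hΞ hn,
    log_rate hL hΞ hn]
  push_cast
  field_simp
  ring

/-- The factor of `σ²` in `Ξ`. -/
noncomputable def varianceConst (d S : ℕ) : ℝ :=
  constC d S * ((S : ℝ) ^ 2 / ((S : ℝ) - 1)) ^ ((S : ℝ) / (2 * d))

theorem varianceConst_pos (d : ℕ) {S : ℕ} (hS : 2 ≤ S) : 0 < varianceConst d S := by
  have h : (2 : ℝ) ≤ S := by exact_mod_cast hS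
  have h1 : (0 : ℝ) < (S : ℝ) - 1 := by linarith
  have h2 : (0 : ℝ) < S := by linarith
  have hlog : 0 < Real.log 2 := Real.log_pos one_lt_two
  have := Real.pi_pos
  unfold varianceConst constC
  positivity

theorem Xi_eq (d S : ℕ) (σ2 : ℝ) (r : (Fin d → ℝ) → ℝ) :
    Xi d S σ2 r = varianceConst d S * σ2
      + 2 * Real.exp (-1) * ⨆ x : Icc (0 : Fin d → ℝ) 1, r x ^ 2 := by
  unfold Xi varianceConst
  ring

end Constants

/-- The constant in front of the rate of convergence. -/
noncomputable def rateConst (d S : ℕ) (c : ℝ) : ℝ :=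
  4 * c / varianceConst d S + (2 * S + 1) * c ^ (-(0.75 / (S * Real.log 2)))
    + Real.exp 1 * c

theorem rateConst_pos (d : ℕ) {S : ℕ} (hS : 2 ≤ S) {c : ℝ} (hc : 0 < c) :
    0 < rateConst d S c := by
  have := varianceConst_pos d hS
  unfold rateConst
  positivity

/-- Since log k decreases in Ξ, the lower bound on Ξ yields a bound that does not depend on the
distribution. -/
theorem log_kChoice_le {d S n : ℕ} (hS : 2 ≤ S) {c L Ξ σ2 : ℝ} (hc : 0 < c) (hL : 0 < L)
    (hσ : 0 < σ2) (hΞ : varianceConst d S * σ2 ≤ Ξ) (hn : 0 < n) :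
    Real.log (kChoice S c L Ξ n)
      ≤ |Real.log c| + |2 * Real.log L - Real.log (varianceConst d S * σ2)| + Real.log n := by
  have hV := mul_pos (varianceConst_pos d hS) hσ
  have hlog : 0 < Real.log 2 := Real.log_pos one_lt_two
  rw [log_kChoice hc hL (hV.trans_le hΞ) hn]
  set b := 1 / (1 + 0.75 / ((S : ℝ) * Real.log 2)) with hb
  have hα : 0 ≤ 0.75 / ((S : ℝ) * Real.log 2) := by positivity
  have hb0 : 0 ≤ b := by positivity
  have hb1 : b ≤ 1 := by
    rw [hb, div_le_one (by positivity)]; linarith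
  have h1 : 2 * Real.log L - Real.log Ξ ≤ |2 * Real.log L - Real.log (varianceConst d S * σ2)| :=
    le_trans (by linarith [Real.log_le_log hV hΞ]) (le_abs_self _)
  have h2 : b * (2 * Real.log L - Real.log Ξ)
      ≤ |2 * Real.log L - Real.log (varianceConst d S * σ2)| :=
    (mul_le_mul_of_nonneg_left h1 hb0).trans (mul_le_of_le_one_left (abs_nonneg _) hb1)
  have h3 : b * Real.log n ≤ Real.log n :=
    mul_le_of_le_one_left (Real.log_natCast_nonneg n) hb1
  linarith [le_abs_self (Real.log c)]

theorem IsSmooth.risk_le_rate {d : ℕ} {𝒮 : Finset (Fin d)} {L σ2 : ℝ}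
    {P : Measure ((Fin d → ℝ) × ℝ)} {rs : (𝒮 → ℝ) → ℝ} (h : IsSmooth 𝒮 L σ2 P rs)
    (hS : 2 ≤ 𝒮.card) (hL : 0 < L) (hσ : 0 < σ2) {c : ℝ} (hc : 0 < c) {q ξ : Fin d → ℝ}
    (hq : ∀ j, q j ∈ Ioo (0 : ℝ) 1) (hq1 : ∑ j, q j = 1)
    (hqξ : ∀ j ∈ 𝒮, q j = 1 / (𝒮.card : ℝ) * (1 + ξ j)) {n : ℕ} (hn : 0 < n)
    (hnL : 2 * σ2 / (n + 1) ≤ L ^ 2)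
    (hξ : ∀ j ∈ 𝒮, 0.75 / (𝒮.card * Real.log 2) * |ξ j| *
      (|Real.log c| + |2 * Real.log L - Real.log (varianceConst d 𝒮.card * σ2)| + Real.log n)
        ≤ Real.log 2) :
    risk n q (kChoice 𝒮.card c L (Xi d 𝒮.card σ2 (lift rs)) n) P (lift rs)
      ≤ ENNReal.ofReal (rateConst d 𝒮.card c
        * rate 𝒮.card L (Xi d 𝒮.card σ2 (lift rs)) n) := by
  have hV := varianceConst_pos d hS
  have hlog : 0 < Real.log 2 := Real.log_pos one_lt_two
  have hS0 : 0 < 𝒮.card := by omega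
  have hSr : (0 : ℝ) < 𝒮.card := by exact_mod_cast hS0
  have hn' : (0 : ℝ) < n := by exact_mod_cast hn
  set R := ⨆ x : Icc (0 : Fin d → ℝ) 1, lift rs x ^ 2 with hR
  have hR0 : 0 ≤ R := Real.iSup_nonneg fun x => sq_nonneg _
  have hXi := Xi_eq d 𝒮.card σ2 (lift rs)
  rw [← hR] at hXi
  set Ξ := Xi d 𝒮.card σ2 (lift rs)
  have hVσ : varianceConst d 𝒮.card * σ2 ≤ Ξ := by
    rw [hXi]; exact le_add_of_nonneg_right (by positivity)
  -- The summand 2e⁻¹R of Ξ controls the empty-cell term, hence the constant e·c in `rateConst`.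
  have hRΞ : 2 * R ≤ Real.exp 1 * Ξ := by
    have h1 : 2 * Real.exp (-1) * R ≤ Ξ := by
      rw [hXi]; exact le_add_of_nonneg_left (by positivity)
    have h2 : Real.exp 1 * (2 * Real.exp (-1) * R) = 2 * R := by
      rw [Real.exp_neg]; field_simp
    rw [← h2]
    gcongr
  have hΞ : 0 < Ξ := (mul_pos hV hσ).trans_le hVσ
  have hk0 := kChoice_pos (S := 𝒮.card) hc hL hΞ hn
  have hr0 := rate_pos (S := 𝒮.card) hL hΞ hn
  have hid1 := Xi_mul_kChoice_div hS0 hc hL hΞ hn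
  have hid2 := sq_mul_kChoice_rpow hS0 hc hL hΞ hn
  have hlogk := log_kChoice_le (n := n) hS hc hL hσ hVσ hn
  refine (h.risk_le hσ.le (fun j => (hq j).1.le) hq1 n _).trans (ENNReal.ofReal_le_ofReal ?_)
  set k := kChoice 𝒮.card c L Ξ n
  set α := 0.75 / ((𝒮.card : ℝ) * Real.log 2) with hα
  have hα0 : 0 ≤ α := by positivity
  have hvar := variance_term_le hk0 hn hσ.le hα0 hnL
  have hbias : ∑ j ∈ 𝒮, (1 - 3 / 4 * q j) ^ ⌈Real.logb 2 k⌉₊ ≤ 𝒮.card * (2 * k ^ (-α)) := by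
    rw [← nsmul_eq_mul]
    refine Finset.sum_le_card_nsmul _ _ _ fun j hj => ?_
    refine bias_term_le hk0 hSr (hqξ j hj) (hq j).1.le (hq j).2.le fun _ => ?_
    exact (mul_le_mul_of_nonneg_left hlogk (by positivity)).trans (hξ j hj)
  have hbias' := mul_le_mul_of_nonneg_left hbias (sq_nonneg L)
  have hempty := mul_le_mul_of_nonneg_left (empty_cell_term_le hk0 hn) hR0
  have hkn : 0 ≤ k / n := by positivity
  have h1 : 4 * σ2 * (k / n) ≤ 4 * c / varianceConst d 𝒮.card * rate 𝒮.card L Ξ n := by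
    have : 4 * c / varianceConst d 𝒮.card * rate 𝒮.card L Ξ n
        = 4 * (Ξ / varianceConst d 𝒮.card) * (k / n) := by
      rw [mul_div_assoc, mul_assoc, div_mul_eq_mul_div, ← hid1]; ring
    rw [this]
    gcongr
    rwa [le_div_iff₀ hV, mul_comm]
  have h2 : R * (2 * (k / n)) ≤ Real.exp 1 * c * rate 𝒮.card L Ξ n := by
    rw [mul_assoc, ← hid1]
    have := mul_le_mul_of_nonneg_right hRΞ hkn
    linarith
  have h3 : L ^ 2 * (𝒮.card * (2 * k ^ (-α)))
      = 2 * 𝒮.card * (c ^ (-α) * rate 𝒮.card L Ξ n) := by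
    rw [← hid2]; ring
  unfold rateConst
  rw [← hα]
  linarith

theorem eventually_mul_abs_mul_add_log_le {u : ℕ → ℝ}
    (hu : Tendsto (fun n : ℕ => u n * Real.log n) atTop (𝓝 0)) (α A : ℝ) {ε : ℝ} (hε : 0 < ε) :
    ∀ᶠ n : ℕ in atTop, α * |u n| * (A + Real.log n) ≤ ε := by
  have hlog : Tendsto (fun n : ℕ => Real.log n) atTop atTop :=
    Real.tendsto_log_atTop.comp tendsto_natCast_atTop_atTop
  have h0 : Tendsto u atTop (𝓝 0) := by
    have := hu.mul (tendsto_inv_atTop_zero.comp hlog)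
    rw [zero_mul] at this
    refine this.congr' ?_
    filter_upwards [hlog.eventually_gt_atTop 0] with n hn
    simp only [Function.comp_apply]
    field_simp
  have h1 : Tendsto (fun n : ℕ => α * (A * |u n| + |u n * Real.log n|)) atTop (𝓝 0) := by
    simpa using ((h0.abs.const_mul A).add hu.abs).const_mul α
  filter_upwards [h1.eventually_le_const hε, hlog.eventually_ge_atTop 0] with n hn hn0
  rw [abs_mul, abs_of_nonneg hn0] at hn
  linarith

end RandomForest

theorem corollary1 (d : ℕ) (𝒮 : Finset (Fin d)) (hS : 2 ≤ 𝒮.card)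
    (p ξ : ℕ → Fin d → ℝ)
    (hp : ∀ n j, p n j ∈ Ioo (0 : ℝ) 1) (hp_sum : ∀ n, ∑ j, p n j = 1)
    (hpξ : ∀ n, ∀ j ∈ 𝒮, p n j = 1 / (𝒮.card : ℝ) * (1 + ξ n j))
    (hξ : ∀ j ∈ 𝒮, Tendsto (fun n : ℕ => ξ n j * Real.log n) atTop (𝓝 0))
    (c : ℝ) (hc : 0 < c) :
    ∃ Λ : ℝ, 0 < Λ ∧ ∀ L σ2 : ℝ, 0 < L → 0 < σ2 →
      limsup (fun n : ℕ =>
        ⨆ (P : Measure ((Fin d → ℝ) × ℝ)) (rs : (𝒮 → ℝ) → ℝ)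
          (_ : RandomForest.IsSmooth 𝒮 L σ2 P rs),
          RandomForest.risk n (p n)
              (RandomForest.kChoice 𝒮.card c L
                (RandomForest.Xi d 𝒮.card σ2 (RandomForest.lift rs)) n)
              P (RandomForest.lift rs)
            / ENNReal.ofReal (RandomForest.rate 𝒮.card L
                (RandomForest.Xi d 𝒮.card σ2 (RandomForest.lift rs)) n))
        atTop ≤ ENNReal.ofReal Λ := by
  refine ⟨RandomForest.rateConst d 𝒮.card c, RandomForest.rateConst_pos d hS hc,
    fun L σ2 hL hσ => limsup_le_of_le (h := ?_)⟩
  -- The thresholds on n may depend on L and σ² but not on the distribution, so the bound holds for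
  -- the supremum itself.
  have hvar : ∀ᶠ n : ℕ in atTop, 2 * σ2 / ((n : ℝ) + 1) ≤ L ^ 2 := by
    have h1 : Tendsto (fun n : ℕ => 2 * σ2 / ((n : ℝ) + 1)) atTop (𝓝 0) :=
      (tendsto_natCast_atTop_atTop.atTop_add tendsto_const_nhds).const_div_atTop _
    exact h1.eventually_le_const (by positivity)
  have hbias := (eventually_all_finset 𝒮).2 fun j hj =>
    RandomForest.eventually_mul_abs_mul_add_log_le (hξ j hj) (0.75 / (𝒮.card * Real.log 2))
      (|Real.log c| + |2 * Real.log L - Real.log (RandomForest.varianceConst d 𝒮.card * σ2)|)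
      (Real.log_pos one_lt_two)
  filter_upwards [hvar, hbias, eventually_gt_atTop 0] with n h1 h2 hn
  refine iSup_le fun P => iSup_le fun rs => iSup_le fun h => ENNReal.div_le_of_le_mul ?_
  rw [← ENNReal.ofReal_mul (RandomForest.rateConst_pos d hS hc).le]
  exact h.risk_le_rate hS hL hσ hc (hp n) (hp_sum n) (hpξ n) hn h1 h2
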